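/- All graphs are finite and simple; "contains" refers to induced subgraphs, and a path in a graph $G$ is an induced subgraph of $G$ that is a path. Disjoint vertex sets $X,Y$ of $G$ are anticomplete if $G$ has no edge between $X$ and $Y$. A graph is $t$-tidy if it is $K_{t+1}$-free and has no induced minor isomorphic to $K_{t,t}$ (an induced minor is a graph obtained from an induced subgraph by contracting edges and deleting the loops and parallel edges that arise). A $q$-banana in $G$ with ends $x\ne y$ is a set $\mathcal P$ of $q$ distinct, pairwise internally disjoint paths in $G$ from $x$ to $y$; it is a $q$-theta if the interiors of any two distinct paths of $\mathcal P$ are anticomplete. A banana with ends $x,y$ is $l$-dense if the set of all vertices on its paths does not contain an $l$-theta with ends $x,y$. For $s\ge 3$, an $(s,d)$-dome in $G$ with root $x$ is a pair $(S,P)$ such that: $S$ is an induced subgraph of $G$ that is a subdivision of the star $K_{1,s}$, with $x$ its vertex of degree $s$ and $L$ its set of $s$ leaves; $P$ is a path in $G$ disjoint from $S$; $V(S)\setminus L$ and $V(P)$ are anticomplete in $G$; every vertex of $L$ has a neighbor in $P$; and every vertex of $P$ is adjacent to at most $d$ vertices of $L$. **Theorem 4.1.** For all integers $l\ge 1$,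 $s\ge 3$, $t\ge 1$ there are constants $f=f(l,s,t)$ and $g=g(t)$ (with $g$ depending only on $t$) such that for every $t$-tidy graph $G$ and all vertices $x,z$ of $G$: if $G$ contains an $l$-dense $f$-banana with ends $x,z$, then $G$ contains an $(s,g)$-dome with root $x$. -/

import Mathlib

namespace BananaDome

variable {V : Type*}

/-- `H` is an induced minor of `G`: there are pairwise disjoint, connected (in particular nonempty)
branch sets in `G`, one for each vertex of `H`, such that two distinct vertices of `H` are adjacent
if and only if `G` has an edge between the corresponding branch sets. (The union of the branch sets
is the vertex set of the induced subgraph; contracting each branch set to a vertex gives `H`.) -/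
def HasInducedMinor {W : Type*} (G : SimpleGraph V) (H : SimpleGraph W) : Prop :=
  ∃ B : W → Set V,
    (∀ w, (G.induce (B w)).Connected) ∧
    (∀ w w', w ≠ w' → Disjoint (B w) (B w')) ∧
    (∀ w w', w ≠ w' → (H.Adj w w' ↔ ∃ a ∈ B w, ∃ b ∈ B w', G.Adj a b))

/-- `G` is `t`-tidy: it is `K_{t+1}`-free and has no induced `K_{t,t}`-minor. -/
structure IsTidy (G : SimpleGraph V) (t : ℕ) : Prop where
  cliqueFree : G.CliqueFree (t + 1)
  no_minor : ¬ HasInducedMinor G (completeBipartiteGraph (Fin t) (Fin t))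

/-- Disjoint vertex sets with no edge of `G` between them. -/
def Anticomplete (G : SimpleGraph V) (X Y : Set V) : Prop :=
  Disjoint X Y ∧ ∀ a ∈ X, ∀ b ∈ Y, ¬ G.Adj a b

/-- `p` traces a path in `G`, that is, an induced subgraph of `G` that is a path
(possibly with a single vertex). -/
def IsInducedPath {G : SimpleGraph V} {a b : V} (p : G.Walk a b) : Prop :=
  p.IsPath ∧ p.IsChordless

/-- The vertex set of the path traced by `p`. -/
def verts {G : SimpleGraph V} {a b : V} (p : G.Walk a b) : Set V :=
  {v | v ∈ p.support}

/-- The vertex set of the interior of the path traced by `p`: all vertices but the two ends. -/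
def interiorVerts {G : SimpleGraph V} {a b : V} (p : G.Walk a b) : Set V :=
  verts p \ {a, b}

/-- A `q`-banana in `G` with ends `x`, `y`: `q` distinct, pairwise internally disjoint (induced)
paths from `x` to `y`. -/
structure IsBanana (G : SimpleGraph V) (q : ℕ) (x y : V) (P : Fin q → G.Walk x y) : Prop where
  ends_ne : x ≠ y
  isInducedPath : ∀ i, IsInducedPath (P i)
  injective : Function.Injective P
  internally_disjoint : ∀ i j, i ≠ j → Disjoint (interiorVerts (P i)) (interiorVerts (P j))

/-- A `q`-theta in `G` with ends `x`, `y`: a `q`-banana whose paths have pairwise anticomplete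
interiors. -/
structure IsTheta (G : SimpleGraph V) (q : ℕ) (x y : V) (P : Fin q → G.Walk x y) : Prop where
  isBanana : IsBanana G q x y P
  anticomplete : ∀ i j, i ≠ j → Anticomplete G (interiorVerts (P i)) (interiorVerts (P j))

/-- The banana given by the paths `P` is `l`-dense: the set of its vertices does not contain an
`l`-theta with the same ends. -/
def IsDense (G : SimpleGraph V) (l : ℕ) {q : ℕ} {x y : V} (P : Fin q → G.Walk x y) : Prop :=
  ¬ ∃ Q : Fin l → G.Walk x y, IsTheta G l x y Q ∧ ∀ i, verts (Q i) ⊆ ⋃ j, verts (P j)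

/-- The legs `Q i`, from `x` to `ℓ i`, form an induced subgraph of `G` that is a subdivided star,
i.e. a subdivision of `K_{1,s}` with `s ≥ 3`. Its root (the unique vertex of degree at least three)
is `x` and its leaf set is the range of `ℓ`, which has exactly `s` elements. -/
structure IsSubdividedStar (G : SimpleGraph V) (s : ℕ) (x : V) (ℓ : Fin s → V)
    (Q : ∀ i, G.Walk x (ℓ i)) : Prop where
  three_le : 3 ≤ s
  isPath : ∀ i, (Q i).IsPath
  leaf_ne_root : ∀ i, ℓ i ≠ x
  inter : ∀ i j, i ≠ j → verts (Q i) ∩ verts (Q j) = {x}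
  induced : ∀ u ∈ ⋃ i, verts (Q i), ∀ v ∈ ⋃ i, verts (Q i), G.Adj u v → ∃ i, s(u, v) ∈ (Q i).edges

/-- The subdivided star with root `x` and legs `Q i` from `x` to the leaves `ℓ i`, together with
the path `p`, is an `(s, d)`-dome in `G`. -/
structure IsDome (G : SimpleGraph V) (s d : ℕ) (x : V) (ℓ : Fin s → V)
    (Q : ∀ i, G.Walk x (ℓ i)) {a b : V} (p : G.Walk a b) : Prop where
  star : IsSubdividedStar G s x ℓ Q
  path : IsInducedPath p
  disjoint : Disjoint (⋃ i, verts (Q i)) (verts p)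
  anticomplete : Anticomplete G ((⋃ i, verts (Q i)) \ Set.range ℓ) (verts p)
  leaf_adj : ∀ v ∈ Set.range ℓ, ∃ u ∈ verts p, G.Adj v u
  adj_le : ∀ u ∈ verts p, {v ∈ Set.range ℓ | G.Adj u v}.ncard ≤ d

/-- `G` has an `(s, d)`-dome with root `x`. -/
def HasDome (G : SimpleGraph V) (s d : ℕ) (x : V) : Prop :=
  ∃ (ℓ : Fin s → V) (Q : ∀ i, G.Walk x (ℓ i)) (a b : V) (p : G.Walk a b), IsDome G s d x ℓ Q p

end BananaDome

/-! Fix a path `P i` of the banana and follow other paths `P j` from `x` up to their first interior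
vertex with a neighbour in the interior of `P i` beyond its first vertex. If these initial parts
have no edges between them away from `x` (`Separated`), they are the legs of a subdivided star, and
the interior of `P i` without its first vertex serves as the path of a dome
(`IsBanana.hasDome_of_separated`); only the degree bound can fail.

If it fails, hypergraph Ramsey yields a vertex of `P i` adjacent to the leaves of many legs. Doing
this for `r` paths `P i` in turn, where any `r` vertices contain `t` stable ones, gives an induced
`K_{t,t}`-minor (`exists_hasDome_of_separated`). This forces a dome with `g = t + r`, which depends
on `t` only.

It remains to find `r` paths with respect to which many other paths are pairwise separated. Density
supplies edges between interiors, and Ramsey either yields the required separation or leaves `t + 3`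
paths where it fails for every triple, relative to both its least and its greatest index. The two
failures squeeze the first attachments until they form a clique (`not_cliqueFree_of_not_separated`).
-/

namespace BananaDome

/-! ### Ramsey theorems for finite sets. -/

section Ramsey

/-- The finite Ramsey theorem for `k`-element subsets and two colours. -/
theorem exists_ramsey (k : ℕ) : ∀ p q : ℕ, ∃ N : ℕ, ∀ (α : Type) [DecidableEq α]
    (c : Finset α → Prop) (S : Finset α), N ≤ S.card →
      (∃ T ⊆ S, T.card = p ∧ ∀ A ⊆ T, A.card = k → c A) ∨
      (∃ T ⊆ S, T.card = q ∧ ∀ A ⊆ T, A.card = k → ¬ c A) := by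
  induction k with
  | zero =>
    intro p q
    refine ⟨max p q, fun α _ c S hS => ?_⟩
    by_cases h : c ∅
    · obtain ⟨T, hT, hc⟩ := Finset.exists_subset_card_eq (le_trans (le_max_left p q) hS)
      refine Or.inl ⟨T, hT, hc, fun A _ hA => ?_⟩
      rwa [Finset.card_eq_zero.mp hA]
    · obtain ⟨T, hT, hc⟩ := Finset.exists_subset_card_eq (le_trans (le_max_right p q) hS)
      refine Or.inr ⟨T, hT, hc, fun A _ hA => ?_⟩
      rwa [Finset.card_eq_zero.mp hA]
  | succ k ih =>
    intro p
    induction p with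
    | zero =>
      refine fun q => ⟨0, fun α _ c S _ => Or.inl ⟨∅, by simp, by simp, fun A hA hc => ?_⟩⟩
      rw [Finset.subset_empty.mp hA] at hc
      simp at hc
    | succ p ihp =>
      intro q
      induction q with
      | zero =>
        refine ⟨0, fun α _ c S _ => Or.inr ⟨∅, by simp, by simp, fun A hA hc => ?_⟩⟩
        rw [Finset.subset_empty.mp hA] at hc
        simp at hc
      | succ q ihq =>
        -- The recursion `R_{k+1}(p+1, q+1) ≤ 1 + R_k(R_{k+1}(p, q+1), R_{k+1}(p+1, q))`: fix `v`
        -- and colour a `k`-set `A` by the colour of `insert v A`.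
        obtain ⟨a, ha⟩ := ihp (q + 1)
        obtain ⟨b, hb⟩ := ihq
        obtain ⟨N, hN⟩ := ih a b
        refine ⟨N + 1, fun α _ c S hS => ?_⟩
        obtain ⟨v, hv⟩ := Finset.card_pos.mp (by omega : 0 < S.card)
        have extend : ∀ (d : Finset α → Prop) (U T : Finset α) (m : ℕ), U ⊆ S.erase v → T ⊆ U →
            T.card = m → (∀ A ⊆ U, A.card = k → d (insert v A)) →
            (∀ A ⊆ T, A.card = k + 1 → d A) →
            ∃ T' ⊆ S, T'.card = m + 1 ∧ ∀ A ⊆ T', A.card = k + 1 → d A := by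
          intro d U T m hU hT hm h1 h2
          have hvT : v ∉ T := fun h => by simpa using hU (hT h)
          refine ⟨insert v T, ?_, by rw [Finset.card_insert_of_notMem hvT, hm], fun A hA hAc => ?_⟩
          · exact Finset.insert_subset hv ((hT.trans hU).trans (Finset.erase_subset _ _))
          · by_cases hvA : v ∈ A
            · rw [← Finset.insert_erase hvA]
              refine h1 _ (fun x hx => hT ?_) (by rw [Finset.card_erase_of_mem hvA]; omega)
              have hx' := Finset.mem_erase.mp hx
              exact Finset.mem_of_mem_insert_of_ne (hA hx'.2) hx'.1
            · exact h2 A ((Finset.subset_insert_iff_of_notMem hvA).mp hA) hAc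
        rcases hN α (fun A => c (insert v A)) (S.erase v)
          (by rw [Finset.card_erase_of_mem hv]; omega) with ⟨U, hU, hUc, hcol⟩ | ⟨U, hU, hUc, hcol⟩
        · rcases ha α c U hUc.ge with ⟨T, hT, hTc, h⟩ | ⟨T, hT, hTc, h⟩
          · exact Or.inl (extend c U T p hU hT hTc hcol h)
          · exact Or.inr ⟨T, (hT.trans hU).trans (Finset.erase_subset _ _), hTc, h⟩
        · rcases hb α c U hUc.ge with ⟨T, hT, hTc, h⟩ | ⟨T, hT, hTc, h⟩
          · exact Or.inl ⟨T, (hT.trans hU).trans (Finset.erase_subset _ _), hTc, h⟩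
          · exact Or.inr (extend (fun A => ¬ c A) U T q hU hT hTc hcol h)

/-- The relation need not be symmetric, so a 2-set is coloured by reading it in increasing order;
triples are treated likewise below. -/
theorem exists_ramsey_pairs (p q : ℕ) : ∃ N : ℕ, ∀ (α : Type) [LinearOrder α]
    (c : α → α → Prop) (S : Finset α), N ≤ S.card →
      (∃ T ⊆ S, T.card = p ∧ ∀ i ∈ T, ∀ j ∈ T, i < j → c i j) ∨
      (∃ T ⊆ S, T.card = q ∧ ∀ i ∈ T, ∀ j ∈ T, i < j → ¬ c i j) := by
  obtain ⟨N, hN⟩ := exists_ramsey 2 p q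
  refine ⟨N, fun α _ c S hS => ?_⟩
  have card : ∀ i j : α, i < j → ({i, j} : Finset α).card = 2 := fun i j h =>
    Finset.card_pair h.ne
  rcases hN α (fun A => ∃ i j, i < j ∧ A = {i, j} ∧ c i j) S hS with
    ⟨T, hT, hTc, h⟩ | ⟨T, hT, hTc, h⟩
  · refine Or.inl ⟨T, hT, hTc, fun i hi j hj hij => ?_⟩
    obtain ⟨i', j', hij', he, hc⟩ := h {i, j} (by grind) (card i j hij)
    have h1 : i' ∈ ({i, j} : Finset α) := by rw [he]; simp
    have h2 : j' ∈ ({i, j} : Finset α) := by rw [he]; simp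
    simp only [Finset.mem_insert, Finset.mem_singleton] at h1 h2
    have : i = i' ∧ j = j' := by
      rcases h1 with rfl | rfl <;> rcases h2 with rfl | rfl <;> first | exact ⟨rfl, rfl⟩ | order
    rwa [this.1, this.2]
  · exact Or.inr ⟨T, hT, hTc, fun i hi j hj hij hc =>
      h {i, j} (by grind) (card i j hij) ⟨i, j, hij, rfl, hc⟩⟩

theorem exists_ramsey_triples (p q : ℕ) : ∃ N : ℕ, ∀ (α : Type) [LinearOrder α]
    (c : α → α → α → Prop) (S : Finset α), N ≤ S.card →
      (∃ T ⊆ S, T.card = p ∧ ∀ i ∈ T, ∀ j ∈ T, ∀ k ∈ T, i < j → j < k → c i j k) ∨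
      (∃ T ⊆ S, T.card = q ∧ ∀ i ∈ T, ∀ j ∈ T, ∀ k ∈ T, i < j → j < k → ¬ c i j k) := by
  obtain ⟨N, hN⟩ := exists_ramsey 3 p q
  refine ⟨N, fun α _ c S hS => ?_⟩
  have card : ∀ i j k : α, i < j → j < k → ({i, j, k} : Finset α).card = 3 := fun i j k h h' =>
    Finset.card_eq_three.mpr ⟨i, j, k, h.ne, (h.trans h').ne, h'.ne, rfl⟩
  rcases hN α (fun A => ∃ i j k, i < j ∧ j < k ∧ A = {i, j, k} ∧ c i j k) S hS with
    ⟨T, hT, hTc, h⟩ | ⟨T, hT, hTc, h⟩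
  · refine Or.inl ⟨T, hT, hTc, fun i hi j hj k hk hij hjk => ?_⟩
    obtain ⟨i', j', k', hij', hjk', he, hc⟩ := h {i, j, k} (by grind) (card i j k hij hjk)
    have h1 : i' ∈ ({i, j, k} : Finset α) := by rw [he]; simp
    have h2 : j' ∈ ({i, j, k} : Finset α) := by rw [he]; simp
    have h3 : k' ∈ ({i, j, k} : Finset α) := by rw [he]; simp
    simp only [Finset.mem_insert, Finset.mem_singleton] at h1 h2 h3
    have : i = i' ∧ j = j' ∧ k = k' := by
      rcases h1 with rfl | rfl | rfl <;> rcases h2 with rfl | rfl | rfl <;>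
        rcases h3 with rfl | rfl | rfl <;> first | exact ⟨rfl, rfl, rfl⟩ | order
    rwa [this.1, this.2.1, this.2.2]
  · exact Or.inr ⟨T, hT, hTc, fun i hi j hj k hk hij hjk hc =>
      h {i, j, k} (by grind) (card i j k hij hjk) ⟨i, j, k, hij, hjk, rfl, hc⟩⟩

theorem exists_initial_subset {α : Type} [LinearOrder α] (r : ℕ) (T : Finset α)
    (hr : r ≤ T.card) :
    ∃ I ⊆ T, I.card = r ∧ ∀ i ∈ I, ∀ j ∈ T \ I, i < j := by
  induction r with
  | zero => exact ⟨∅, by simp, by simp, by simp⟩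
  | succ r ih =>
    obtain ⟨I, hI, hc, hlt⟩ := ih (by omega)
    have hne : (T \ I).Nonempty := by
      rw [← Finset.card_pos, Finset.card_sdiff_of_subset hI]; omega
    have hm := Finset.min'_mem (T \ I) hne
    have hm' := Finset.mem_sdiff.mp hm
    refine ⟨insert ((T \ I).min' hne) I, Finset.insert_subset hm'.1 hI,
      by rw [Finset.card_insert_of_notMem hm'.2, hc], fun i hi j hj => ?_⟩
    simp only [Finset.mem_sdiff, Finset.mem_insert, not_or] at hj
    rcases Finset.mem_insert.mp hi with rfl | hi
    · exact lt_of_le_of_ne (Finset.min'_le _ _ (Finset.mem_sdiff.mpr ⟨hj.1, hj.2.2⟩))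
        (Ne.symm hj.2.1)
    · exact hlt i hi j (Finset.mem_sdiff.mpr ⟨hj.1, hj.2.2⟩)

end Ramsey

/-! ### Stable sets and induced minors. -/

section Cliques

variable {V : Type*} {G : SimpleGraph V} {t : ℕ}

theorem not_clique_of_cliqueFree {α : Type} [LinearOrder α] (hG : G.CliqueFree (t + 1))
    (u : α → V) (T : Finset α) (hT : T.card = t + 1) :
    ¬ ∀ i ∈ T, ∀ j ∈ T, i < j → G.Adj (u i) (u j) := by
  classical
  intro h
  have hadj : ∀ i ∈ T, ∀ j ∈ T, i ≠ j → G.Adj (u i) (u j) := fun i hi j hj hij => by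
    rcases lt_or_gt_of_ne hij with h' | h'
    · exact h i hi j hj h'
    · exact (h j hj i hi h').symm
  have hinj : Set.InjOn u (T : Set α) := fun i hi j hj hij => by
    by_contra hne
    exact (hadj i hi j hj hne).ne hij
  refine hG (T.image u) ⟨?_, by rw [Finset.card_image_of_injOn hinj, hT]⟩
  intro a ha b hb hab
  obtain ⟨i, hi, rfl⟩ := Finset.mem_image.mp (Finset.mem_coe.mp ha)
  obtain ⟨j, hj, rfl⟩ := Finset.mem_image.mp (Finset.mem_coe.mp hb)
  exact hadj i hi j hj fun h => hab (h ▸ rfl)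

/-- Ramsey for pairs, where a large clique is excluded. The bound is uniform in the graph; `u` may
repeat vertices, since equal vertices are non-adjacent. -/
theorem exists_stable_of_cliqueFree (t m : ℕ) : ∃ r : ℕ, ∀ (α : Type) [LinearOrder α]
    (S : Finset α), r ≤ S.card → ∀ {V : Type*} (G : SimpleGraph V), G.CliqueFree (t + 1) →
      ∀ u : α → V, ∃ T ⊆ S, T.card = m ∧ ∀ i ∈ T, ∀ j ∈ T, i ≠ j → ¬ G.Adj (u i) (u j) := by
  obtain ⟨r, hr⟩ := exists_ramsey_pairs (t + 1) m
  refine ⟨r, fun α _ S hS V G hG u => ?_⟩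
  rcases hr α (fun i j => G.Adj (u i) (u j)) S hS with ⟨T, -, hTc, h⟩ | ⟨T, hT, hTc, h⟩
  · exact (not_clique_of_cliqueFree hG u T hTc h).elim
  · refine ⟨T, hT, hTc, fun i hi j hj hij hadj => ?_⟩
    rcases lt_or_gt_of_ne hij with h' | h'
    · exact h i hi j hj h' hadj
    · exact h j hj i hi h' hadj.symm

/-- Two families of `t` pairwise anticomplete connected sets, any two sets of different families
being disjoint and joined by an edge, form an induced `K_{t,t}`-minor. -/
theorem hasInducedMinor_of_families {α β : Type} {A : Finset α} {B : Finset β} (hA : A.card = t)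
    (hB : B.card = t) (X : α → Set V) (Y : β → Set V)
    (hX : ∀ i ∈ A, (G.induce (X i)).Connected) (hY : ∀ i ∈ B, (G.induce (Y i)).Connected)
    (hXX : ∀ i ∈ A, ∀ j ∈ A, i ≠ j → Anticomplete G (X i) (X j))
    (hYY : ∀ i ∈ B, ∀ j ∈ B, i ≠ j → Anticomplete G (Y i) (Y j))
    (hXY : ∀ i ∈ A, ∀ j ∈ B, Disjoint (X i) (Y j))
    (hadj : ∀ i ∈ A, ∀ j ∈ B, ∃ a ∈ X i, ∃ b ∈ Y j, G.Adj a b) :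
    HasInducedMinor G (completeBipartiteGraph (Fin t) (Fin t)) := by
  set e := (A.equivFinOfCardEq hA).symm
  set f := (B.equivFinOfCardEq hB).symm
  have he : ∀ {i j}, i ≠ j → (e i : α) ≠ e j := fun h h' => h (e.injective (Subtype.ext h'))
  have hf : ∀ {i j}, i ≠ j → (f i : β) ≠ f j := fun h h' => h (f.injective (Subtype.ext h'))
  refine ⟨Sum.elim (fun i => X (e i)) (fun i => Y (f i)), ?_, ?_, ?_⟩
  · rintro (i | i)
    exacts [hX _ (e i).2, hY _ (f i).2]
  · rintro (i | i) (j | j) hij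
    · exact (hXX _ (e i).2 _ (e j).2 (he fun h => hij (h ▸ rfl))).1
    · exact hXY _ (e i).2 _ (f j).2
    · exact (hXY _ (e j).2 _ (f i).2).symm
    · exact (hYY _ (f i).2 _ (f j).2 (hf fun h => hij (h ▸ rfl))).1
  · rintro (i | i) (j | j) hij
    · simpa using (hXX _ (e i).2 _ (e j).2 (he fun h => hij (h ▸ rfl))).2
    · simpa using hadj _ (e i).2 _ (f j).2
    · obtain ⟨a, ha, b, hb, h⟩ := hadj _ (e j).2 _ (f i).2
      simpa using ⟨b, hb, a, ha, h.symm⟩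
    · simpa using (hYY _ (f i).2 _ (f j).2 (hf fun h => hij (h ▸ rfl))).2

theorem connected_induce_singleton (v : V) : (G.induce ({v} : Set V)).Connected := by
  simp

end Cliques

/-! ### Segments of induced paths. -/

section Walks

variable {V : Type*} {G : SimpleGraph V} {x y : V}

/-- The part of the walk `p` between its vertices number `a` and `a + n`. -/
abbrev segment (p : G.Walk x y) (a n : ℕ) := (p.drop a).take n

theorem mem_verts_take {p : G.Walk x y} {n : ℕ} (hn : n ≤ p.length) {v : V} :
    v ∈ verts (p.take n) ↔ ∃ k ≤ n, p.getVert k = v := by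
  simp only [verts, Set.mem_ofPred_eq, SimpleGraph.Walk.mem_support_iff_exists_getVert,
    SimpleGraph.Walk.take_getVert, SimpleGraph.Walk.take_length]
  constructor
  · rintro ⟨k, hk, hk'⟩
    exact ⟨n ⊓ k, by omega, hk⟩
  · rintro ⟨k, hk, rfl⟩
    exact ⟨k, by rw [min_eq_right hk], by omega⟩

theorem mem_verts_segment {p : G.Walk x y} {a n : ℕ} (hn : a + n ≤ p.length) {v : V} :
    v ∈ verts (segment p a n) ↔ ∃ k, a ≤ k ∧ k ≤ a + n ∧ p.getVert k = v := by
  rw [segment, mem_verts_take (by rw [SimpleGraph.Walk.drop_length]; omega)]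
  constructor
  · rintro ⟨k, hk, rfl⟩
    exact ⟨a + k, by omega, by omega, by rw [SimpleGraph.Walk.drop_getVert]⟩
  · rintro ⟨k, hk, hk', rfl⟩
    exact ⟨k - a, by omega, by rw [SimpleGraph.Walk.drop_getVert]; congr 1; omega⟩

theorem IsInducedPath.adj_getVert_iff {p : G.Walk x y} (hp : IsInducedPath p) {a b : ℕ}
    (hab : a ≤ b) (hb : b ≤ p.length) :
    G.Adj (p.getVert a) (p.getVert b) ↔ b = a + 1 := by
  constructor
  · intro h
    obtain ⟨i, hi, he⟩ := (SimpleGraph.Walk.mk_mem_edges_iff_exists _).mp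
      (hp.2.mem_edges (p.getVert_mem_support a) (p.getVert_mem_support b) h)
    have inj : ∀ c d, c ≤ p.length → d ≤ p.length → p.getVert c = p.getVert d → c = d :=
      fun c d hc hd h => hp.1.getVert_injOn hc hd h
    rcases Sym2.eq_iff.mp he with ⟨h1, h2⟩ | ⟨h1, h2⟩
    · have := inj _ _ (by omega) (by omega) h1
      have := inj _ _ (by omega) (by omega) h2
      omega
    · have := inj _ _ (by omega) (by omega) h1
      have := inj _ _ (by omega) (by omega) h2
      omega
  · rintro rfl
    exact p.adj_getVert_succ (by omega)

theorem IsInducedPath.take {p : G.Walk x y} (hp : IsInducedPath p) {n : ℕ} (hn : n ≤ p.length) :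
    IsInducedPath (p.take n) := by
  refine ⟨hp.1.take n, SimpleGraph.Walk.isChordless_iff_forall_mem_edges.mpr ?_⟩
  intro u v hu hv hadj
  obtain ⟨a, ha, rfl⟩ := (mem_verts_take hn).mp hu
  obtain ⟨b, hb, rfl⟩ := (mem_verts_take hn).mp hv
  rw [SimpleGraph.Walk.mk_mem_edges_iff_exists]
  simp only [SimpleGraph.Walk.take_getVert, SimpleGraph.Walk.take_length]
  rcases le_total a b with hab | hab
  · have := (hp.adj_getVert_iff hab (by omega)).mp hadj
    exact ⟨a, by omega, by rw [min_eq_right (by omega), min_eq_right (by omega), this]⟩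
  · have := (hp.adj_getVert_iff hab (by omega)).mp hadj.symm
    exact ⟨b, by omega, by rw [min_eq_right (by omega), min_eq_right (by omega), this, Sym2.eq_swap]⟩

theorem IsInducedPath.drop {p : G.Walk x y} (hp : IsInducedPath p) {n : ℕ} (hn : n ≤ p.length) :
    IsInducedPath (p.drop n) := by
  have key : ∀ k, n ≤ k → k < p.length →
      s(p.getVert k, p.getVert (k + 1)) ∈ (p.drop n).edges := by
    intro k hk hk'
    rw [SimpleGraph.Walk.mk_mem_edges_iff_exists]
    simp only [SimpleGraph.Walk.drop_getVert, SimpleGraph.Walk.drop_length]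
    exact ⟨k - n, by omega, by rw [show n + (k - n) = k by omega,
      show n + (k - n + 1) = k + 1 by omega]⟩
  refine ⟨hp.1.drop n, SimpleGraph.Walk.isChordless_iff_forall_mem_edges.mpr ?_⟩
  intro u v hu hv hadj
  obtain ⟨a, rfl, ha⟩ := SimpleGraph.Walk.mem_support_iff_exists_getVert.mp hu
  obtain ⟨b, rfl, hb⟩ := SimpleGraph.Walk.mem_support_iff_exists_getVert.mp hv
  rw [SimpleGraph.Walk.drop_length] at ha hb
  rw [SimpleGraph.Walk.drop_getVert, SimpleGraph.Walk.drop_getVert] at *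
  rcases le_total a b with hab | hab
  · have := (hp.adj_getVert_iff (by omega) (by omega)).mp hadj
    rw [this]
    exact key _ (by omega) (by omega)
  · have := (hp.adj_getVert_iff (by omega) (by omega)).mp hadj.symm
    rw [this, Sym2.eq_swap]
    exact key _ (by omega) (by omega)

end Walks

/-! ### Attachments, and the dome built from separated paths. -/

section Banana

variable {V : Type*} {G : SimpleGraph V} {q : ℕ} {x z : V} {P : Fin q → G.Walk x z}

/-- The `k`-th vertex of `P j` is interior and has a neighbour among the interior vertices of `P i`
other than the first one. -/
def Attaches (P : Fin q → G.Walk x z) (j i : Fin q) (k : ℕ) : Prop :=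
  1 ≤ k ∧ k < (P j).length ∧
    ∃ m, 2 ≤ m ∧ m < (P i).length ∧ G.Adj ((P j).getVert k) ((P i).getVert m)

/-- The position of the first interior vertex of `P j` that attaches to `P i`. -/
noncomputable def firstAttach (P : Fin q → G.Walk x z) (j i : Fin q) : ℕ :=
  sInf {k | Attaches P j i k}

/-- The initial parts of `P j` and `P k`, up to their first attachments to `P i`, have no edge
between them apart from those at `x`. -/
def Separated (P : Fin q → G.Walk x z) (i j k : Fin q) : Prop :=
  ∀ a b, 1 ≤ a → a ≤ firstAttach P j i → 1 ≤ b → b ≤ firstAttach P k i →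
    ¬ G.Adj ((P j).getVert a) ((P k).getVert b)

theorem attaches_firstAttach {j i : Fin q} (h : ∃ k, Attaches P j i k) :
    Attaches P j i (firstAttach P j i) :=
  Nat.sInf_mem h

theorem firstAttach_le {j i : Fin q} {k : ℕ} (h : Attaches P j i k) : firstAttach P j i ≤ k :=
  Nat.sInf_le h

theorem not_attaches_of_lt {j i : Fin q} {k : ℕ} (h : k < firstAttach P j i) :
    ¬ Attaches P j i k :=
  fun h' => (firstAttach_le h').not_gt h

theorem Separated.symm {i j k : Fin q} (h : Separated P i j k) : Separated P i k j :=
  fun a b ha ha' hb hb' hadj => h b a hb hb' ha ha' hadj.symm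

theorem IsBanana.getVert_mem_interiorVerts (hP : IsBanana G q x z P) (i : Fin q) {a : ℕ}
    (ha : 1 ≤ a) (ha' : a < (P i).length) : (P i).getVert a ∈ interiorVerts (P i) := by
  refine ⟨(P i).getVert_mem_support a, ?_⟩
  have hp := (hP.isInducedPath i).1
  rintro (h | h)
  · have := (hp.getVert_eq_start_iff ha'.le).mp h
    omega
  · have := (hp.getVert_eq_end_iff ha'.le).mp h
    omega

theorem IsBanana.exists_getVert_of_mem_interiorVerts (i : Fin q) {v : V}
    (hv : v ∈ interiorVerts (P i)) : ∃ a, 1 ≤ a ∧ a < (P i).length ∧ (P i).getVert a = v := by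
  obtain ⟨a, rfl, ha⟩ := SimpleGraph.Walk.mem_support_iff_exists_getVert.mp hv.1
  have h0 : a ≠ 0 := by
    rintro rfl
    exact hv.2 (by simp)
  have h1 : a ≠ (P i).length := by
    rintro rfl
    exact hv.2 (by simp)
  exact ⟨a, by omega, by omega, rfl⟩

theorem IsBanana.getVert_ne (hP : IsBanana G q x z P) {i j : Fin q} (hij : i ≠ j) {a b : ℕ}
    (ha : 1 ≤ a) (ha' : a < (P i).length) : (P i).getVert a ≠ (P j).getVert b := by
  intro h
  have hi := hP.getVert_mem_interiorVerts i ha ha'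
  refine Set.disjoint_left.mp (hP.internally_disjoint i j hij) hi ⟨?_, hi.2⟩
  rw [h]
  exact (P j).getVert_mem_support b

/-- The legs are the `P j` cut at their first attachment to `P i`. Separation makes the star
induced, and minimality of the first attachment keeps all vertices but the leaves away from the
path. -/
theorem IsBanana.hasDome_of_separated (hP : IsBanana G q x z P) {s d : ℕ} (hs : 3 ≤ s) {i : Fin q}
    {T : Finset (Fin q)} (hT : T.card = s) (hi : i ∉ T) (hatt : ∀ j ∈ T, ∃ k, Attaches P j i k)
    (hsep : ∀ j ∈ T, ∀ k ∈ T, j ≠ k → Separated P i j k)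
    (hdeg : ∀ m, 2 ≤ m → m < (P i).length → ∀ A ⊆ T,
      (∀ j ∈ A, G.Adj ((P i).getVert m) ((P j).getVert (firstAttach P j i))) → A.card ≤ d) :
    HasDome G s d x := by
  classical
  set e : Fin s → Fin q := fun a => T.orderEmbOfFin hT a with he
  have heT : ∀ a, e a ∈ T := T.orderEmbOfFin_mem hT
  have hinj : Function.Injective e := (T.orderEmbOfFin hT).injective
  have hsur : ∀ j ∈ T, ∃ a, e a = j := fun j hj => by
    have : j ∈ Set.range (T.orderEmbOfFin hT) := by rw [T.range_orderEmbOfFin hT]; exact hj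
    exact this
  set n : Fin s → ℕ := fun a => firstAttach P (e a) i with hn
  have hnatt : ∀ a, Attaches P (e a) i (n a) := fun a => attaches_firstAttach (hatt _ (heT a))
  have hn1 : ∀ a, 1 ≤ n a := fun a => (hnatt a).1
  have hnl : ∀ a, n a < (P (e a)).length := fun a => (hnatt a).2.1
  have hei : ∀ a, e a ≠ i := fun a h => hi (h ▸ heT a)
  obtain ⟨-, -, m₀, hm₀, hm₀', -⟩ := hnatt ⟨0, by omega⟩
  -- The segment runs through vertices `2` to `length - 1`; `m₀` guarantees that `length` is at
  -- least 3, so the subtraction is not truncated.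
  have hseg : 2 + ((P i).length - 3) ≤ (P i).length := by omega
  have hleg : ∀ a v, v ∈ verts ((P (e a)).take (n a)) ↔
      ∃ k ≤ n a, (P (e a)).getVert k = v := fun a v => mem_verts_take (hnl a).le
  have hpath : ∀ v, v ∈ verts (segment (P i) 2 ((P i).length - 3)) ↔
      ∃ m, 2 ≤ m ∧ m < (P i).length ∧ (P i).getVert m = v := fun v => by
    rw [mem_verts_segment hseg]
    constructor
    · rintro ⟨m, h1, h2, h3⟩
      exact ⟨m, h1, by omega, h3⟩
    · rintro ⟨m, h1, h2, h3⟩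
      exact ⟨m, h1, by omega, h3⟩
  have hleafinj : ∀ a b, (P (e a)).getVert (n a) = (P (e b)).getVert (n b) → a = b := by
    intro a b h
    by_contra hab
    exact hP.getVert_ne (hinj.ne hab) (hn1 a) (hnl a) h
  have hrootadj : ∀ j k, k ≤ (P j).length → (G.Adj x ((P j).getVert k) ↔ k = 1) := by
    intro j k hk
    have := (hP.isInducedPath j).adj_getVert_iff (Nat.zero_le k) hk
    rwa [SimpleGraph.Walk.getVert_zero] at this
  have hdisj : Disjoint (⋃ a, verts ((P (e a)).take (n a)))
      (verts (segment (P i) 2 ((P i).length - 3))) := by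
    rw [Set.disjoint_left]
    intro v hv hv'
    obtain ⟨a, ha⟩ := Set.mem_iUnion.mp hv
    obtain ⟨k, -, rfl⟩ := (hleg a v).mp ha
    obtain ⟨m, h1, h2, h3⟩ := (hpath _).mp hv'
    exact hP.getVert_ne (hei a).symm (by omega) h2 h3
  refine ⟨fun a => (P (e a)).getVert (n a), fun a => (P (e a)).take (n a), _, _,
    segment (P i) 2 ((P i).length - 3), ⟨⟨hs, ?_, ?_, ?_, ?_⟩, ?_, hdisj, ⟨?_, ?_⟩, ?_, ?_⟩⟩
  · exact fun a => (hP.isInducedPath _).1.take _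
  · intro a h
    exact (hP.getVert_mem_interiorVerts (e a) (hn1 a) (hnl a)).2 (Or.inl h)
  · intro a b hab
    ext v
    rw [Set.mem_inter_iff, hleg, hleg, Set.mem_singleton_iff]
    constructor
    · rintro ⟨⟨k, hk, rfl⟩, ⟨k', hk', h⟩⟩
      by_contra hne
      have hk0 : 1 ≤ k := by
        rcases Nat.eq_zero_or_pos k with rfl | h0
        · exact (hne (by simp)).elim
        · exact h0
      exact hP.getVert_ne (hinj.ne hab) hk0 (hk.trans_lt (hnl a)) h.symm
    · rintro rfl
      exact ⟨⟨0, by omega, by simp⟩, ⟨0, by omega, by simp⟩⟩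
  · intro u hu v hv hadj
    obtain ⟨a, ha⟩ := Set.mem_iUnion.mp hu
    obtain ⟨b, hb⟩ := Set.mem_iUnion.mp hv
    have same : ∀ c, u ∈ verts ((P (e c)).take (n c)) → v ∈ verts ((P (e c)).take (n c)) →
        ∃ i, s(u, v) ∈ ((P (e i)).take (n i)).edges := fun c h1 h2 =>
      ⟨c, ((hP.isInducedPath _).take (hnl c).le).2.mem_edges h1 h2 hadj⟩
    obtain ⟨k, hk, hku⟩ := (hleg a u).mp ha
    obtain ⟨k', hk', hkv⟩ := (hleg b v).mp hb
    rcases Nat.eq_zero_or_pos k with rfl | hk0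
    · refine same b ((hleg b u).mpr ⟨0, by omega, ?_⟩) hb
      rw [← hku]; simp
    rcases Nat.eq_zero_or_pos k' with rfl | hk0'
    · refine same a ha ((hleg a v).mpr ⟨0, by omega, ?_⟩)
      rw [← hkv]; simp
    by_cases hab : a = b
    · subst hab
      exact same a ha hb
    · rw [← hku, ← hkv] at hadj
      exact (hsep _ (heT a) _ (heT b) (hinj.ne hab) k k' hk0 hk hk0' hk' hadj).elim
  · exact ((hP.isInducedPath i).drop (by omega)).take
      (by rw [SimpleGraph.Walk.drop_length]; omega)
  · exact hdisj.mono_left Set.sdiff_subset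
  · rintro u ⟨hu, hul⟩ v hv hadj
    obtain ⟨a, ha⟩ := Set.mem_iUnion.mp hu
    obtain ⟨k, hk, rfl⟩ := (hleg a u).mp ha
    obtain ⟨m, h1, h2, rfl⟩ := (hpath v).mp hv
    -- On `P i` the root is adjacent to vertex 1 only, which is why the path of the dome starts at
    -- vertex 2.
    rcases Nat.eq_zero_or_pos k with rfl | hk0
    · rw [SimpleGraph.Walk.getVert_zero, hrootadj i m h2.le] at hadj
      omega
    · have hlt : k < n a := lt_of_le_of_ne hk fun h => hul ⟨a, by rw [h]⟩
      exact not_attaches_of_lt hlt ⟨hk0, hlt.trans (hnl a), m, h1, h2, hadj⟩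
  · rintro v ⟨a, rfl⟩
    obtain ⟨-, -, m, h1, h2, h3⟩ := hnatt a
    exact ⟨_, (hpath _).mpr ⟨m, h1, h2, rfl⟩, h3⟩
  · intro u hu
    obtain ⟨m, h1, h2, rfl⟩ := (hpath u).mp hu
    set A := T.filter fun j => G.Adj ((P i).getVert m) ((P j).getVert (firstAttach P j i)) with hA
    refine le_trans ?_ (hdeg m h1 h2 A (Finset.filter_subset _ _)
      fun j hj => (Finset.mem_filter.mp hj).2)
    rw [← Set.ncard_coe_finset]
    have hsub : {v | v ∈ Set.range (fun a => (P (e a)).getVert (n a)) ∧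
        G.Adj ((P i).getVert m) v} ⊆ (fun j => (P j).getVert (firstAttach P j i)) '' (A : Set (Fin q)) := by
      rintro v ⟨⟨a, rfl⟩, hadj⟩
      exact ⟨e a, Finset.mem_coe.mpr (Finset.mem_filter.mpr ⟨heT a, hadj⟩), rfl⟩
    exact (Set.ncard_le_ncard hsub (A.finite_toSet.image _)).trans
      (Set.ncard_image_le A.finite_toSet)

end Banana

/-! ### Domes from separated families of paths. -/

section Separated

universe u

/-- Given many pairwise separated paths attaching to `P i`, either there is a dome whose path is
part of `P i`, or some vertex of `P i` is adjacent to the first attachment of many of them. -/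
theorem hasDome_or_exists_common_neighbor {t r : ℕ} (hr : ∀ (α : Type) [LinearOrder α]
    (S : Finset α), r ≤ S.card → ∀ {V : Type u} (G : SimpleGraph V), G.CliqueFree (t + 1) →
      ∀ u : α → V, ∃ T ⊆ S, T.card = t ∧ ∀ i ∈ T, ∀ j ∈ T, i ≠ j → ¬ G.Adj (u i) (u j))
    {s : ℕ} (hs : 3 ≤ s) (m : ℕ) :
    ∃ M : ℕ, ∀ (V : Type u) (G : SimpleGraph V), IsTidy G t →
      ∀ (q : ℕ) (x z : V) (P : Fin q → G.Walk x z), IsBanana G q x z P →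
      ∀ (i : Fin q) (J : Finset (Fin q)), M ≤ J.card → i ∉ J →
        (∀ j ∈ J, ∃ k, Attaches P j i k) →
        (∀ j ∈ J, ∀ k ∈ J, j ≠ k → Separated P i j k) →
        HasDome G s (t + r) x ∨ ∃ J' ⊆ J, J'.card = m ∧ ∃ u, 2 ≤ u ∧ u < (P i).length ∧
          ∀ j ∈ J', G.Adj ((P i).getVert u) ((P j).getVert (firstAttach P j i)) := by
  classical
  -- A `(t + r)`-set of paths is coloured by whether its first attachments have a common neighbour
  -- on `P i`. If no such subset of `T` does, the degree bound holds.
  obtain ⟨M, hM⟩ := exists_ramsey (t + r) (max m (t + r)) s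
  refine ⟨M, fun V G hG q x z P hP i J hJ hi hatt hsep => ?_⟩
  set c : Finset (Fin q) → Prop := fun A => ∃ u, 2 ≤ u ∧ u < (P i).length ∧
    ∀ j ∈ A, G.Adj ((P i).getVert u) ((P j).getVert (firstAttach P j i)) with hc
  rcases hM (Fin q) c J hJ with ⟨T, hT, hTc, h⟩ | ⟨T, hT, hTc, h⟩
  swap
  · left
    refine hP.hasDome_of_separated hs hTc (fun h => hi (hT h)) (fun j hj => hatt j (hT hj))
      (fun j hj k hk => hsep j (hT hj) k (hT hk)) (fun u hu hu' A hA hadj => ?_)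
    by_contra hlt
    obtain ⟨A', hA', hAc⟩ := Finset.exists_subset_card_eq (not_le.mp hlt).le
    exact h A' (hA'.trans hA) hAc ⟨u, hu, hu', fun j hj => hadj j (hA' hj)⟩
  right
  -- A Helly-type argument: common neighbours of all `(t + r)`-subsets force one for all of `T`.
  -- Otherwise each `u` misses some `w u` in `T`.
  suffices hT' : c T by
    obtain ⟨T', hT', hTc'⟩ := Finset.exists_subset_card_eq ((le_max_left m (t + r)).trans hTc.ge)
    obtain ⟨u, hu, hu', hadj⟩ := ‹c T›
    exact ⟨T', hT'.trans hT, hTc', u, hu, hu', fun j hj => hadj j (hT' hj)⟩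
  by_contra hcT
  have hex : ∀ u, ∃ w, 2 ≤ u → u < (P i).length →
      w ∈ T ∧ ¬ G.Adj ((P i).getVert u) ((P w).getVert (firstAttach P w i)) := by
    intro u
    by_cases hu : 2 ≤ u ∧ u < (P i).length
    · by_contra hno
      push Not at hno
      exact hcT ⟨u, hu.1, hu.2, fun j hj => (hno j).2.2 hj⟩
    · exact ⟨i, fun h1 h2 => (hu ⟨h1, h2⟩).elim⟩
  choose w hw using hex
  have hTge : t + r ≤ T.card := (le_max_right m (t + r)).trans hTc.ge
  obtain ⟨T₀, hT₀, hT₀c⟩ := Finset.exists_subset_card_eq (show t ≤ T.card by omega)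
  set C := (Finset.range (P i).length).filter fun u => 2 ≤ u ∧
    ∀ j ∈ T₀, G.Adj ((P i).getVert u) ((P j).getVert (firstAttach P j i)) with hC
  -- `t` leaves have fewer than `r` common neighbours on `P i`: among `r` of them, `t` would be
  -- stable and form an induced `K_{t,t}` with the leaves.
  have hCr : C.card < r := by
    by_contra hge
    obtain ⟨D, hD, hDc, hDs⟩ := hr ℕ C (not_lt.mp hge) G hG.cliqueFree (P i).getVert
    have hDC : ∀ u ∈ D, 2 ≤ u ∧ u < (P i).length ∧
        ∀ j ∈ T₀, G.Adj ((P i).getVert u) ((P j).getVert (firstAttach P j i)) := fun u hu => by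
      have := hD hu
      simp only [hC, Finset.mem_filter, Finset.mem_range] at this
      exact ⟨this.2.1, this.1, this.2.2⟩
    have hJT : ∀ j ∈ T₀, j ∈ J := fun j hj => hT (hT₀ hj)
    have hat : ∀ j ∈ T₀, Attaches P j i (firstAttach P j i) := fun j hj =>
      attaches_firstAttach (hatt j (hJT j hj))
    refine hG.no_minor (hasInducedMinor_of_families hT₀c hDc
      (fun j => {(P j).getVert (firstAttach P j i)}) (fun u => {(P i).getVert u})
      (fun j _ => connected_induce_singleton _) (fun j _ => connected_induce_singleton _) ?_ ?_ ?_ ?_)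
    · intro j hj k hk hjk
      refine ⟨Set.disjoint_singleton.mpr (hP.getVert_ne hjk (hat j hj).1 (hat j hj).2.1), ?_⟩
      rintro _ rfl _ rfl
      exact hsep j (hJT j hj) k (hJT k hk) hjk _ _ (hat j hj).1 le_rfl (hat k hk).1 le_rfl
    · intro a ha b hb hab
      refine ⟨Set.disjoint_singleton.mpr fun h => hab ?_, ?_⟩
      · exact (hP.isInducedPath i).1.getVert_injOn (hDC a ha).2.1.le (hDC b hb).2.1.le h
      · rintro _ rfl _ rfl
        exact hDs a ha b hb hab
    · intro j hj u hu
      have hji : j ≠ i := fun h => hi (h ▸ hJT j hj)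
      exact Set.disjoint_singleton.mpr (hP.getVert_ne hji (hat j hj).1 (hat j hj).2.1)
    · intro j hj u hu
      exact ⟨_, rfl, _, rfl, ((hDC u hu).2.2 j hj).symm⟩
  have hCT : T₀ ∪ C.image w ⊆ T := by
    refine Finset.union_subset hT₀ (Finset.image_subset_iff.mpr fun u hu => ?_)
    simp only [hC, Finset.mem_filter, Finset.mem_range] at hu
    exact (hw u hu.2.1 hu.1).1
  have hcard : (T₀ ∪ C.image w).card ≤ t + r :=
    (Finset.card_union_le _ _).trans (by
      have := Finset.card_image_le (s := C) (f := w)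
      omega)
  -- A common neighbour `u` of `A ⊇ T₀` lies in `C`, yet `A` also contains the path `w u` that it
  -- misses.
  obtain ⟨A, hA₀, hAT, hAc⟩ := Finset.exists_subsuperset_card_eq hCT hcard hTge
  obtain ⟨u, hu, hu', hadj⟩ := h A hAT hAc
  have huC : u ∈ C := by
    simp only [hC, Finset.mem_filter, Finset.mem_range]
    exact ⟨hu', hu, fun j hj => hadj j (hA₀ (Finset.mem_union_left _ hj))⟩
  exact (hw u hu hu').2 (hadj _ (hA₀ (Finset.mem_union_right _ (Finset.mem_image_of_mem w huC))))

/-- Iterates the previous dichotomy over the paths in `I`, shrinking `J` each time. -/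
theorem hasDome_or_exists_common_neighbors {t r : ℕ} (hr : ∀ (α : Type) [LinearOrder α]
    (S : Finset α), r ≤ S.card → ∀ {V : Type u} (G : SimpleGraph V), G.CliqueFree (t + 1) →
      ∀ u : α → V, ∃ T ⊆ S, T.card = t ∧ ∀ i ∈ T, ∀ j ∈ T, i ≠ j → ¬ G.Adj (u i) (u j))
    {s : ℕ} (hs : 3 ≤ s) (n m : ℕ) :
    ∃ M : ℕ, ∀ (V : Type u) (G : SimpleGraph V), IsTidy G t →
      ∀ (q : ℕ) (x z : V) (P : Fin q → G.Walk x z), IsBanana G q x z P →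
      ∀ (I J : Finset (Fin q)), I.card = n → M ≤ J.card → Disjoint I J →
        (∀ i ∈ I, ∀ j ∈ J, ∃ k, Attaches P j i k) →
        (∀ i ∈ I, ∀ j ∈ J, ∀ k ∈ J, j ≠ k → Separated P i j k) →
        HasDome G s (t + r) x ∨ ∃ J' ⊆ J, J'.card = m ∧ ∃ u : Fin q → ℕ, ∀ i ∈ I,
          2 ≤ u i ∧ u i < (P i).length ∧
          ∀ j ∈ J', G.Adj ((P i).getVert (u i)) ((P j).getVert (firstAttach P j i)) := by
  induction n with
  | zero =>
    refine ⟨m, fun V G _ q x z P _ I J hI hJ _ _ _ => Or.inr ?_⟩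
    obtain ⟨J', hJ', hc⟩ := Finset.exists_subset_card_eq hJ
    refine ⟨J', hJ', hc, fun _ => 0, fun i hi => ?_⟩
    rw [Finset.card_eq_zero.mp hI] at hi
    simp at hi
  | succ n ih =>
    obtain ⟨M₁, hM₁⟩ := ih
    obtain ⟨M, hM⟩ := hasDome_or_exists_common_neighbor hr hs M₁
    refine ⟨M, fun V G hG q x z P hP I J hI hJ hd hatt hsep => ?_⟩
    obtain ⟨i, I', hi, rfl, hI'⟩ := Finset.card_eq_succ.mp hI
    rw [Finset.disjoint_insert_left] at hd
    rcases hM V G hG q x z P hP i J hJ hd.1 (hatt i (by simp)) (hsep i (by simp)) with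
      h | ⟨J₁, hJ₁, hJ₁c, v, hv, hv', hadj⟩
    · exact Or.inl h
    rcases hM₁ V G hG q x z P hP I' J₁ hI' hJ₁c.ge (hd.2.mono_right hJ₁)
      (fun k hk j hj => hatt k (Finset.mem_insert_of_mem hk) j (hJ₁ hj))
      (fun k hk j hj j' hj' => hsep k (Finset.mem_insert_of_mem hk) j (hJ₁ hj) j' (hJ₁ hj')) with
      h | ⟨J', hJ', hJc, u, hu⟩
    · exact Or.inl h
    refine Or.inr ⟨J', hJ'.trans hJ₁, hJc, Function.update u i v, fun k hk => ?_⟩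
    by_cases hki : k = i
    · subst hki
      rw [Function.update_self]
      exact ⟨hv, hv', fun j hj => hadj j (hJ' hj)⟩
    · rw [Function.update_of_ne hki]
      exact hu k (Finset.mem_of_mem_insert_of_ne hk hki)

/-- A banana in a tidy graph yields a dome if the paths in a large set `J` attach to each of `r`
further paths, and their initial parts up to the first attachment are pairwise separated. -/
theorem exists_hasDome_of_separated {t r : ℕ} (ht : 1 ≤ t) (hr : ∀ (α : Type) [LinearOrder α]
    (S : Finset α), r ≤ S.card → ∀ {V : Type u} (G : SimpleGraph V), G.CliqueFree (t + 1) →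
      ∀ u : α → V, ∃ T ⊆ S, T.card = t ∧ ∀ i ∈ T, ∀ j ∈ T, i ≠ j → ¬ G.Adj (u i) (u j))
    {s : ℕ} (hs : 3 ≤ s) :
    ∃ M : ℕ, ∀ (V : Type u) (G : SimpleGraph V), IsTidy G t →
      ∀ (q : ℕ) (x z : V) (P : Fin q → G.Walk x z), IsBanana G q x z P →
      ∀ (I J : Finset (Fin q)), I.card = r → M ≤ J.card → Disjoint I J →
        (∀ i ∈ I, ∀ j ∈ J, ∃ k, Attaches P j i k) →
        (∀ i ∈ I, ∀ j ∈ J, ∀ k ∈ J, j ≠ k → Separated P i j k) →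
        HasDome G s (t + r) x := by
  classical
  obtain ⟨M, hM⟩ := hasDome_or_exists_common_neighbors hr hs r (t * t)
  refine ⟨M, fun V G hG q x z P hP I J hI hJ hd hatt hsep => ?_⟩
  rcases hM V G hG q x z P hP I J hI hJ hd hatt hsep with h | ⟨J', hJ', hJc, u, hu⟩
  · exact h
  exfalso
  obtain ⟨I', hI', hIc, hst⟩ := hr (Fin q) I hI.ge G hG.cliqueFree fun i => (P i).getVert (u i)
  have hne : I'.Nonempty := Finset.card_pos.mp (by omega)
  -- Each `P j` has a path in `I'` to which it attaches last. By pigeonhole, `t` of the `t * t`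
  -- paths share this last path `i₀`. Their initial parts up to it are pairwise anticomplete and
  -- contain the first attachments to all paths in `I'`, so they form one side of a `K_{t,t}`-minor.
  choose f hf using fun j => Finset.exists_max_image I' (fun i => firstAttach P j i) hne
  obtain ⟨i₀, hi₀, hcard⟩ := Finset.exists_le_card_fiber_of_mul_le_card_of_maps_to
    (s := J') (t := I') (f := f) (n := t) (fun j _ => (hf j).1) hne (by rw [hIc, hJc])
  obtain ⟨K, hK, hKc⟩ := Finset.exists_subset_card_eq hcard
  have hKJ : ∀ j ∈ K, j ∈ J' ∧ f j = i₀ := fun j hj => Finset.mem_filter.mp (hK hj)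
  have hat : ∀ i ∈ I', ∀ j ∈ K, Attaches P j i (firstAttach P j i) := fun i hi j hj =>
    attaches_firstAttach (hatt i (hI' hi) j (hJ' (hKJ j hj).1))
  have hmem : ∀ j ∈ K, ∀ v, v ∈ verts (segment (P j) 1 (firstAttach P j i₀ - 1)) ↔
      ∃ k, 1 ≤ k ∧ k ≤ firstAttach P j i₀ ∧ (P j).getVert k = v := by
    intro j hj v
    have h1 := (hat i₀ hi₀ j hj).1
    have h2 := (hat i₀ hi₀ j hj).2.1
    rw [mem_verts_segment (by omega), show 1 + (firstAttach P j i₀ - 1) = firstAttach P j i₀ by omega]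
  have hneIK : ∀ i ∈ I', ∀ j ∈ K, i ≠ j := fun i hi j hj h =>
    Finset.disjoint_left.mp hd (hI' hi) (h ▸ hJ' (hKJ j hj).1)
  refine hG.no_minor (hasInducedMinor_of_families hKc hIc
    (fun j => verts (segment (P j) 1 (firstAttach P j i₀ - 1))) (fun i => {(P i).getVert (u i)})
    (fun j _ => SimpleGraph.Walk.connected_induce_support _)
    (fun i _ => connected_induce_singleton _) ?_ ?_ ?_ ?_)
  · intro j hj k hk hjk
    refine ⟨Set.disjoint_left.mpr fun v hv hv' => ?_, fun v hv v' hv' => ?_⟩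
    · obtain ⟨a, ha, ha', rfl⟩ := (hmem j hj v).mp hv
      obtain ⟨b, hb, hb', h⟩ := (hmem k hk _).mp hv'
      exact hP.getVert_ne hjk ha (ha'.trans_lt (hat i₀ hi₀ j hj).2.1) h.symm
    · obtain ⟨a, ha, ha', rfl⟩ := (hmem j hj v).mp hv
      obtain ⟨b, hb, hb', rfl⟩ := (hmem k hk _).mp hv'
      exact hsep i₀ (hI' hi₀) j (hJ' (hKJ j hj).1) k (hJ' (hKJ k hk).1) hjk a b ha ha' hb hb'
  · intro i hi k hk hik
    have hui := hu i (hI' hi)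
    refine ⟨Set.disjoint_singleton.mpr (hP.getVert_ne hik (by omega) hui.2.1), ?_⟩
    rintro _ rfl _ rfl
    exact hst i hi k hk hik
  · intro j hj i hi
    have hui := hu i (hI' hi)
    rw [Set.disjoint_singleton_right, hmem j hj]
    rintro ⟨k, -, -, h⟩
    exact hP.getVert_ne (hneIK i hi j hj) (by omega) hui.2.1 h.symm
  · intro j hj i hi
    have hle : firstAttach P j i ≤ firstAttach P j i₀ := by
      have := (hf j).2 i hi
      rwa [(hKJ j hj).2] at this
    exact ⟨_, (hmem j hj _).mpr ⟨_, (hat i hi j hj).1, hle, rfl⟩, _, rfl,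
      ((hu i (hI' hi)).2.2 j (hKJ j hj).1).symm⟩

end Separated

/-! ### Finding separated families in a dense banana. -/

section Main

universe u

variable {V : Type u} {G : SimpleGraph V} {q : ℕ} {x z : V} {P : Fin q → G.Walk x z}

theorem IsBanana.not_isDense_of_anticomplete (hP : IsBanana G q x z P) {l : ℕ}
    {T : Finset (Fin q)} (hT : T.card = l)
    (h : ∀ i ∈ T, ∀ j ∈ T, i < j → ∀ a b, 1 ≤ a → a < (P i).length → 1 ≤ b →
      b < (P j).length → ¬ G.Adj ((P i).getVert a) ((P j).getVert b)) : ¬ IsDense G l P := by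
  set e := T.orderEmbOfFin hT
  have heT : ∀ a, e a ∈ T := T.orderEmbOfFin_mem hT
  refine not_not_intro ⟨fun i => P (e i), ⟨⟨hP.ends_ne, fun i => hP.isInducedPath _,
    hP.injective.comp e.injective,
    fun i j hij => hP.internally_disjoint _ _ (e.injective.ne hij)⟩, fun i j hij =>
    ⟨hP.internally_disjoint _ _ (e.injective.ne hij), fun v hv w hw hadj => ?_⟩⟩,
    fun i => Set.subset_iUnion (fun j => verts (P j)) (e i)⟩
  obtain ⟨a, ha, ha', rfl⟩ := IsBanana.exists_getVert_of_mem_interiorVerts _ hv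
  obtain ⟨b, hb, hb', rfl⟩ := IsBanana.exists_getVert_of_mem_interiorVerts _ hw
  rcases lt_or_gt_of_ne hij with hlt | hlt
  · exact h _ (heT i) _ (heT j) (e.lt_iff_lt.mpr hlt) a b ha ha' hb hb' hadj
  · exact h _ (heT j) _ (heT i) (e.lt_iff_lt.mpr hlt) b a hb hb' ha ha' hadj.symm

/-- If in a family of `t + 3` mutually attaching paths no two are separated with respect to a
third that precedes or follows both of them, then `G` has a clique of size `t + 1`. -/
theorem not_cliqueFree_of_not_separated {t : ℕ} {T : Finset (Fin q)} (hT : T.card = t + 3)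
    (hst : ∀ i ∈ T, ∀ j ∈ T, i ≠ j → ¬ G.Adj ((P i).getVert 1) ((P j).getVert 1))
    (hno : ∀ i ∈ T, ∀ j ∈ T, i ≠ j → ¬ Attaches P j i 1)
    (hatt : ∀ i ∈ T, ∀ j ∈ T, i ≠ j → ∃ k, Attaches P j i k)
    (hmin : ∀ i ∈ T, ∀ j ∈ T, ∀ k ∈ T, i < j → j < k → ¬ Separated P i j k)
    (hmax : ∀ i ∈ T, ∀ j ∈ T, ∀ k ∈ T, i < j → j < k → ¬ Separated P k i j) :
    ¬ G.CliqueFree (t + 1) := by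
  -- An edge violating separation has no end at a first vertex, so its ends are attachments of `P j`
  -- and `P k` to each other. This gives the lower bounds on `a` and `b`.
  have key : ∀ i ∈ T, ∀ j ∈ T, ∀ k ∈ T, i ≠ j → i ≠ k → j ≠ k → ¬ Separated P i j k →
      ∃ a b, firstAttach P j k ≤ a ∧ a ≤ firstAttach P j i ∧ firstAttach P k j ≤ b ∧
        b ≤ firstAttach P k i ∧ G.Adj ((P j).getVert a) ((P k).getVert b) := by
    intro i hi j hj k hk hij hik hjk hsep
    simp only [Separated, not_forall, not_not] at hsep
    obtain ⟨a, b, ha, ha', hb, hb', hadj⟩ := hsep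
    have hal := ha'.trans_lt (attaches_firstAttach (hatt i hi j hj hij)).2.1
    have hbl := hb'.trans_lt (attaches_firstAttach (hatt i hi k hk hik)).2.1
    have hor : 2 ≤ a ∨ 2 ≤ b := by
      by_contra hlt
      have h1 : a = 1 := by omega
      have h2 : b = 1 := by omega
      subst h1 h2
      exact hst j hj k hk hjk hadj
    have ha2 : 2 ≤ a := by
      by_contra hlt
      have h1 : a = 1 := by omega
      subst h1
      exact hno k hk j hj hjk.symm ⟨le_rfl, hal, b, by omega, hbl, hadj⟩
    have hb2 : 2 ≤ b := by
      by_contra hlt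
      have h1 : b = 1 := by omega
      subst h1
      exact hno j hj k hk hjk ⟨le_rfl, hbl, a, by omega, hal, hadj.symm⟩
    exact ⟨a, b, firstAttach_le ⟨ha, hal, b, hb2, hbl, hadj⟩, ha',
      firstAttach_le ⟨hb, hbl, a, ha2, hal, hadj.symm⟩, hb', hadj⟩
  -- The least index `m` and a greatest index `M` are set aside; the `t + 1` indices `K` between
  -- them will give the clique.
  obtain ⟨A, hA, hAc, hAlt⟩ := exists_initial_subset 1 T (by omega)
  obtain ⟨m, rfl⟩ := Finset.card_eq_one.mp hAc
  have hmT : m ∈ T := hA (by simp)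
  have hTm : (T \ {m}).card = t + 2 := by
    rw [Finset.card_sdiff_of_subset hA, hT, hAc]; omega
  obtain ⟨K, hK, hKc, hKlt⟩ := exists_initial_subset (t + 1) (T \ {m}) (by omega)
  obtain ⟨M, hM⟩ := Finset.card_pos.mp
    (by rw [Finset.card_sdiff_of_subset hK]; omega : 0 < ((T \ {m}) \ K).card)
  have hMT : M ∈ T := (Finset.mem_sdiff.mp (Finset.mem_sdiff.mp hM).1).1
  have hKT : ∀ i ∈ K, i ∈ T ∧ m < i ∧ i < M := fun i hi =>
    ⟨(Finset.mem_sdiff.mp (hK hi)).1, hAlt m (by simp) i (hK hi), hKlt i hi M hM⟩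
  -- Failure relative to `i` gives one inequality, and failure relative to `k` the reverse one.
  have tri : ∀ i ∈ T, ∀ j ∈ T, ∀ k ∈ T, i < j → j < k →
      firstAttach P j i = firstAttach P j k := by
    intro i hi j hj k hk hij hjk
    obtain ⟨a, b, h1, h2, -⟩ := key i hi j hj k hk hij.ne (hij.trans hjk).ne hjk.ne
      (hmin i hi j hj k hk hij hjk)
    obtain ⟨a', b', -, -, h3, h4, -⟩ := key k hk i hi j hj (hij.trans hjk).ne' hjk.ne' hij.ne
      (hmax i hi j hj k hk hij hjk)
    omega
  refine fun hG => not_clique_of_cliqueFree hG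
    (fun j => (P j).getVert (firstAttach P j m)) K hKc fun j hj k hk hjk => ?_
  obtain ⟨hjT, hmj, hjM⟩ := hKT j hj
  obtain ⟨hkT, hmk, hkM⟩ := hKT k hk
  obtain ⟨a, b, h1, h2, h3, h4, hadj⟩ := key m hmT j hjT k hkT hmj.ne hmk.ne hjk.ne
    (hmin m hmT j hjT k hkT hmj hjk)
  have e1 := tri m hmT j hjT k hkT hmj hjk
  have e2 := tri m hmT k hkT M hMT hmk hkM
  have e3 := tri j hjT k hkT M hMT hjk hkM
  -- By `tri`, the lower and upper bounds on `a` coincide, and so do those on `b`. Hence the edge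
  -- joins the first attachments to `P m`.
  have ea : a = firstAttach P j m := by omega
  have eb : b = firstAttach P k m := by omega
  rwa [← ea, ← eb]

theorem exists_hasDome_of_isDense {t : ℕ} (ht : 1 ≤ t) : ∃ d : ℕ, ∀ l s : ℕ, 3 ≤ s →
    ∃ N : ℕ, ∀ (V : Type u) (G : SimpleGraph V), IsTidy G t →
      ∀ (x z : V) (P : Fin N → G.Walk x z), IsBanana G N x z P → IsDense G l P →
        HasDome G s d x := by
  classical
  obtain ⟨r, hr⟩ := exists_stable_of_cliqueFree.{u} t t
  refine ⟨t + r, fun l s hs => ?_⟩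
  obtain ⟨M, hM⟩ := exists_hasDome_of_separated ht hr hs
  -- The Ramsey numbers are fixed in the reverse of the order in which they are applied.
  obtain ⟨n₁, hn₁⟩ := exists_ramsey_triples (r + M) (t + 3)
  obtain ⟨n₂, hn₂⟩ := exists_ramsey_triples (r + M) n₁
  obtain ⟨n₃, hn₃⟩ := exists_ramsey_pairs l n₂
  obtain ⟨n₄, hn₄⟩ := exists_ramsey_pairs (r + M) n₃
  obtain ⟨n₅, hn₅⟩ := exists_ramsey_pairs (r + M) n₄
  obtain ⟨N, hN⟩ := exists_stable_of_cliqueFree.{u} t n₅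
  refine ⟨N, fun V G hG x z P hP hdense => ?_⟩
  -- The Ramsey outcomes concern ordered tuples, so `I` is taken entirely below or entirely above
  -- `J`.
  have low : ∀ T : Finset (Fin N), T.card = r + M → ∃ I ⊆ T, ∃ J ⊆ T, I.card = r ∧ J.card = M ∧
      ∀ i ∈ I, ∀ j ∈ J, i < j := fun T hT => by
    obtain ⟨I, hI, hIc, hlt⟩ := exists_initial_subset r T (by omega)
    exact ⟨I, hI, T \ I, Finset.sdiff_subset, hIc,
      by rw [Finset.card_sdiff_of_subset hI]; omega, hlt⟩
  have high : ∀ T : Finset (Fin N), T.card = r + M → ∃ I ⊆ T, ∃ J ⊆ T, I.card = r ∧ J.card = M ∧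
      ∀ i ∈ I, ∀ j ∈ J, j < i := fun T hT => by
    obtain ⟨J, hJ, hJc, hlt⟩ := exists_initial_subset M T (by omega)
    exact ⟨T \ J, Finset.sdiff_subset, J, hJ, by rw [Finset.card_sdiff_of_subset hJ]; omega, hJc,
      fun i hi j hj => hlt j hj i hi⟩
  have dome : ∀ I J : Finset (Fin N), I.card = r → J.card = M → (∀ i ∈ I, ∀ j ∈ J, i ≠ j) →
      (∀ i ∈ I, ∀ j ∈ J, ∃ k, Attaches P j i k) →
      (∀ i ∈ I, ∀ j ∈ J, ∀ k ∈ J, j < k → Separated P i j k) → HasDome G s (t + r) x := by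
    intro I J hI hJ hne hatt hsep
    refine hM V G hG N x z P hP I J hI hJ.ge
      (Finset.disjoint_left.mpr fun i hi hi' => hne i hi i hi' rfl) hatt fun i hi j hj k hk hjk => ?_
    rcases lt_or_gt_of_ne hjk with h | h
    · exact hsep i hi j hj k hk h
    · exact (hsep i hi k hk j hj h).symm
  obtain ⟨T₅, -, hT₅c, hst⟩ := hN (Fin N) Finset.univ (by simp) G hG.cliqueFree
    fun i => (P i).getVert 1
  -- Attachment at vertex 1 reduces the initial parts to first vertices, which are stable by the
  -- choice of `T₅`.
  have domeFirst : ∀ I ⊆ T₅, ∀ J ⊆ T₅, I.card = r → J.card = M → (∀ i ∈ I, ∀ j ∈ J, i ≠ j) →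
      (∀ i ∈ I, ∀ j ∈ J, Attaches P j i 1) → HasDome G s (t + r) x := by
    intro I _ J hJ hIc hJc hne hatt
    refine dome I J hIc hJc hne (fun i hi j hj => ⟨1, hatt i hi j hj⟩) ?_
    intro i hi j hj k hk hjk a b ha ha' hb hb'
    have h1 : a = 1 := le_antisymm (ha'.trans (firstAttach_le (hatt i hi j hj))) ha
    have h2 : b = 1 := le_antisymm (hb'.trans (firstAttach_le (hatt i hi k hk))) hb
    rw [h1, h2]
    exact hst j (hJ hj) k (hJ hk) hjk.ne
  rcases hn₅ (Fin N) (fun i j => Attaches P j i 1) T₅ hT₅c.ge with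
    ⟨T, hT, hTc, h⟩ | ⟨T₄, hT₄, hT₄c, h₄⟩
  · obtain ⟨I, hI, J, hJ, hIc, hJc, hlt⟩ := low T hTc
    exact domeFirst I (hI.trans hT) J (hJ.trans hT) hIc hJc (fun i hi j hj => (hlt i hi j hj).ne)
      fun i hi j hj => h i (hI hi) j (hJ hj) (hlt i hi j hj)
  rcases hn₄ (Fin N) (fun i j => Attaches P i j 1) T₄ hT₄c.ge with
    ⟨T, hT, hTc, h⟩ | ⟨T₃, hT₃, hT₃c, h₃⟩
  · obtain ⟨I, hI, J, hJ, hIc, hJc, hlt⟩ := high T hTc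
    exact domeFirst I ((hI.trans hT).trans hT₄) J ((hJ.trans hT).trans hT₄) hIc hJc
      (fun i hi j hj => (hlt i hi j hj).ne') fun i hi j hj => h j (hJ hj) i (hI hi) (hlt i hi j hj)
  have hno : ∀ i ∈ T₃, ∀ j ∈ T₃, i ≠ j → ¬ Attaches P j i 1 := fun i hi j hj hij => by
    rcases lt_or_gt_of_ne hij with h | h
    · exact h₄ i (hT₃ hi) j (hT₃ hj) h
    · exact h₃ j hj i hi h
  rcases hn₃ (Fin N) (fun i j => ∀ a b, 1 ≤ a → a < (P i).length → 1 ≤ b → b < (P j).length →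
      ¬ G.Adj ((P i).getVert a) ((P j).getVert b)) T₃ hT₃c.ge with
    ⟨T, -, hTc, h⟩ | ⟨T₂, hT₂, hT₂c, h₂⟩
  · exact (hP.not_isDense_of_anticomplete hTc h hdense).elim
  -- Any two interiors are now joined by an edge. It avoids both first vertices, so it is an
  -- attachment in either direction.
  have hatt' : ∀ i ∈ T₂, ∀ j ∈ T₂, i < j → (∃ k, Attaches P j i k) ∧ ∃ k, Attaches P i j k := by
    intro i hi j hj hij
    have h := h₂ i hi j hj hij
    simp only [not_forall, not_not] at h
    obtain ⟨a, b, ha, ha', hb, hb', hadj⟩ := h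
    have hij' := hno i (hT₂ hi) j (hT₂ hj) hij.ne
    have hji' := hno j (hT₂ hj) i (hT₂ hi) hij.ne'
    have hor : 2 ≤ a ∨ 2 ≤ b := by
      by_contra hlt
      have h1 : a = 1 := by omega
      have h2 : b = 1 := by omega
      subst h1 h2
      exact hst i (hT₄ (hT₃ (hT₂ hi))) j (hT₄ (hT₃ (hT₂ hj))) hij.ne hadj
    have ha2 : 2 ≤ a := by
      by_contra hlt
      have h1 : a = 1 := by omega
      subst h1
      exact hji' ⟨le_rfl, ha', b, by omega, hb', hadj⟩
    have hb2 : 2 ≤ b := by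
      by_contra hlt
      have h1 : b = 1 := by omega
      subst h1
      exact hij' ⟨le_rfl, hb', a, by omega, ha', hadj.symm⟩
    exact ⟨⟨b, hb, hb', a, ha2, ha', hadj.symm⟩, a, ha, ha', b, hb2, hb', hadj⟩
  have hatt : ∀ i ∈ T₂, ∀ j ∈ T₂, i ≠ j → ∃ k, Attaches P j i k := fun i hi j hj hij => by
    rcases lt_or_gt_of_ne hij with h | h
    · exact (hatt' i hi j hj h).1
    · exact (hatt' j hj i hi h).2
  rcases hn₂ (Fin N) (fun i j k => Separated P i j k) T₂ hT₂c.ge with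
    ⟨T, hT, hTc, h⟩ | ⟨T₁, hT₁, hT₁c, h₁⟩
  · obtain ⟨I, hI, J, hJ, hIc, hJc, hlt⟩ := low T hTc
    exact dome I J hIc hJc (fun i hi j hj => (hlt i hi j hj).ne)
      (fun i hi j hj => hatt i (hT (hI hi)) j (hT (hJ hj)) (hlt i hi j hj).ne)
      fun i hi j hj k hk hjk => h i (hI hi) j (hJ hj) k (hJ hk) (hlt i hi j hj) hjk
  rcases hn₁ (Fin N) (fun i j k => Separated P k i j) T₁ hT₁c.ge with
    ⟨T, hT, hTc, h⟩ | ⟨T₀, hT₀, hT₀c, h₀⟩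
  · obtain ⟨I, hI, J, hJ, hIc, hJc, hlt⟩ := high T hTc
    exact dome I J hIc hJc (fun i hi j hj => (hlt i hi j hj).ne')
      (fun i hi j hj => hatt i (hT₁ (hT (hI hi))) j (hT₁ (hT (hJ hj))) (hlt i hi j hj).ne')
      fun i hi j hj k hk hjk => h j (hJ hj) k (hJ hk) i (hI hi) hjk (hlt i hi k hk)
  have h02 : T₀ ⊆ T₂ := hT₀.trans hT₁
  have h05 : T₀ ⊆ T₅ := ((h02.trans hT₂).trans hT₃).trans hT₄
  exact (not_cliqueFree_of_not_separated hT₀c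
    (fun i hi j hj => hst i (h05 hi) j (h05 hj))
    (fun i hi j hj => hno i (hT₂ (h02 hi)) j (hT₂ (h02 hj)))
    (fun i hi j hj => hatt i (h02 hi) j (h02 hj))
    (fun i hi j hj k hk => h₁ i (hT₀ hi) j (hT₀ hj) k (hT₀ hk))
    h₀ hG.cliqueFree).elim

end Main

end BananaDome

theorem theorem4p1 :
    ∃ (f : ℕ → ℕ → ℕ → ℕ) (g : ℕ → ℕ), ∀ l s t : ℕ, 1 ≤ l → 3 ≤ s → 1 ≤ t →
      ∀ (V : Type*) [Finite V] (G : SimpleGraph V), BananaDome.IsTidy G t →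
        ∀ (x z : V) (P : Fin (f l s t) → G.Walk x z),
          BananaDome.IsBanana G (f l s t) x z P → BananaDome.IsDense G l P →
            BananaDome.HasDome G s (g t) x := by
  -- `d` is quantified before `l` and `s`, so that `choose` makes `g` a function of `t` alone.
  -- Outside the range of the parameters the values are 0.
  have h : ∀ t : ℕ, ∃ d : ℕ, ∀ l s : ℕ, ∃ N : ℕ, 1 ≤ t → 3 ≤ s → ∀ (V : Type _)
      (G : SimpleGraph V), BananaDome.IsTidy G t → ∀ (x z : V) (P : Fin N → G.Walk x z),
        BananaDome.IsBanana G N x z P → BananaDome.IsDense G l P → BananaDome.HasDome G s d x := by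
    intro t
    by_cases ht : 1 ≤ t
    · obtain ⟨d, hd⟩ := BananaDome.exists_hasDome_of_isDense ht
      refine ⟨d, fun l s => ?_⟩
      by_cases hs : 3 ≤ s
      · obtain ⟨N, hN⟩ := hd l s hs
        exact ⟨N, fun _ _ => hN⟩
      · exact ⟨0, fun _ h => (hs h).elim⟩
    · exact ⟨0, fun _ _ => ⟨0, fun h => (ht h).elim⟩⟩
  choose g hg using h
  choose f hf using hg
  exact ⟨fun l s t => f t l s, g, fun l s t _ hs ht V _ G hG => hf t l s ht hs V G hG⟩
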